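/- Let $a,b>0$ be real and let $g\in L^2(\mathbb R)$ (complex-valued functions, Lebesgue measure, $\langle f,h\rangle=\int f\,\overline h$). For $c\in\mathbb R$ let $E_c f(x)=e^{2\pi i c x}f(x)$ and $T_c f(x)=f(x-c)$ on $L^2(\mathbb R)$. Suppose that $(E_{mb}T_{na}g)_{m,n\in\mathbb Z}$ is a frame for $L^2(\mathbb R)$, i.e. there are $A,B>0$ with $$A\|f\|^2\le\sum_{m,n\in\mathbb Z}|\langle f,E_{mb}T_{na}g\rangle|^2\le B\|f\|^2\quad\text{for all } f\in L^2(\mathbb R).$$ Then the frame operator $Sf=\sum_{m,n\in\mathbb Z}\langle f,E_{mb}T_{na}g\rangle E_{mb}T_{na}g$ (unconditional convergence in norm) is a well-defined bounded, positive, boundedly invertible operator on $L^2(\mathbb R)$, and the following hold. (1) $S^{-1}g\perp E_{n/a}T_{m/b}g$ for all $(m,n)\in\mathbb Z^2\setminus\{(0,0)\}$, and $$\langle S^{-1}g,g\rangle=\langle S^{-1/2}g,S^{-1/2}g\rangle=\|S^{-1/2}g\|^2=ab\le 1.$$ (2) If $ab<1$, then $(E_{mb}T_{na}g)_{m,n\in\mathbb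 Z}$ is not a Riesz basis for $L^2(\mathbb R)$. (3) If $ab=1$, then $(E_{mb}T_{na}g)_{m,n\in\mathbb Z}$ is a Riesz basis for $L^2(\mathbb R)$. Here a family $(f_i)_{i\in I}$ in a Hilbert space $H$ is a Riesz basis for $H$ if there are an orthonormal basis $(e_i)_{i\in I}$ of $H$ and a bounded linear bijection $T:H\to H$ with bounded inverse such that $f_i=Te_i$ for all $i$. -/

import Mathlib

open MeasureTheory
open scoped ENNReal

noncomputable section

/-- The Hilbert space `L²(ℝ)` of complex-valued functions, with Lebesgue measure. -/
abbrev L2R : Type := Lp ℂ 2 (volume : Measure ℝ)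

/-- The character `x ↦ e^{2πibx}`. -/
def expChar (b x : ℝ) : ℂ := Complex.exp (2 * Real.pi * Complex.I * b * x)

theorem norm_expChar (b x : ℝ) : ‖expChar b x‖ = 1 := by
  have h : (2 * Real.pi * Complex.I * b * x : ℂ) = ((2 * Real.pi * b * x : ℝ) : ℂ) * Complex.I := by
    push_cast; ring
  rw [expChar, h, Complex.norm_exp_ofReal_mul_I]

theorem continuous_expChar (b : ℝ) : Continuous (expChar b) := by
  unfold expChar; fun_prop

theorem memLp_expChar_mul (b : ℝ) (f : L2R) :
    MemLp (fun x => expChar b x * f x) 2 (volume : Measure ℝ) :=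
  (Lp.memLp f).of_le
    ((continuous_expChar b).aestronglyMeasurable.mul (Lp.aestronglyMeasurable f))
    (Filter.Eventually.of_forall fun x => by simp [norm_expChar])

/-- Modulation on `L²(ℝ)`: `(E_b f)(x) = e^{2πibx} f(x)`. -/
def modulation (b : ℝ) (f : L2R) : L2R := (memLp_expChar_mul b f).toLp

/-- Translation on `L²(ℝ)`: `(T_a f)(x) = f(x - a)`. -/
def translation (a : ℝ) (f : L2R) : L2R :=
  Lp.compMeasurePreserving (fun x : ℝ => x - a) (measurePreserving_sub_right volume a) f

/-- The Weyl-Heisenberg system `(E_{mb} T_{na} g)`, indexed by `(m, n) ∈ ℤ × ℤ`. -/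
def whSystem (g : L2R) (a b : ℝ) (p : ℤ × ℤ) : L2R :=
  modulation (p.1 * b) (translation (p.2 * a) g)

section Hilbert

variable {I H : Type*} [NormedAddCommGroup H] [InnerProductSpace ℂ H]

/-- A family `F` is a frame: there are `A, B > 0` with
`A ‖f‖² ≤ ∑ᵢ |⟨f, Fᵢ⟩|² ≤ B ‖f‖²` for all `f`. (The upper bound contains the
convergence of the series; Mathlib's `inner ℂ x y` is linear in `y`, so `⟨f, Fᵢ⟩` is
`inner ℂ (F i) f`.) -/
def IsFrame (F : I → H) : Prop :=
  ∃ A B : ℝ, 0 < A ∧ 0 < B ∧ ∀ f : H,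
    Summable (fun i => ‖inner ℂ (F i) f‖ ^ 2) ∧
    A * ‖f‖ ^ 2 ≤ ∑' i, ‖inner ℂ (F i) f‖ ^ 2 ∧
    ∑' i, ‖inner ℂ (F i) f‖ ^ 2 ≤ B * ‖f‖ ^ 2

/-- `S` is the frame operator of the family `F`: `S f = ∑ᵢ ⟨f, Fᵢ⟩ Fᵢ` for all `f`, with
unconditional convergence in norm. There is at most one such `S`. -/
def IsFrameOperator (F : I → H) (S : H →L[ℂ] H) : Prop :=
  ∀ f : H, HasSum (fun i => inner ℂ (F i) f • F i) (S f)

/-- A family `F` is a Riesz basis of `H`: it is the image of an orthonormal basis of `H` under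
a bounded invertible operator on `H`. -/
def IsRieszBasis (F : I → H) : Prop :=
  ∃ (e : HilbertBasis I ℂ H) (T : H ≃L[ℂ] H), ∀ i, F i = T (e i)

/-- The operator `S^{-1/2}`, for a positive invertible bounded operator `S` on a complex Hilbert
space, through the continuous functional calculus. -/
def invSqrt [CompleteSpace H] (S : H →L[ℂ] H) : H →L[ℂ] H := S ^ (-1 / 2 : ℝ)

end Hilbert

end

/-! Put `γ = S⁻¹g` and write `g_p`, `γ_p` for the shifted windows. Since `S` commutes with the
shifts `E_{mb}T_{na}`, `S⁻¹g_p = γ_p`, and hence `∑ ⟨f, γ_p⟩⟨g_p, h⟩ = ⟨f, h⟩`. The Wexler-Raz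
relations (`integral_mul_conj_of_hasSum_dual`) turn this into biorthogonality on the dual lattice:
`γ ⊥ E_{k/a}T_{l/b}g` unless `k = l = 0`, and `⟨γ, g⟩ = ab`. They come from Parseval in `m`, tested
on short intervals, followed by unfolding the sum over `n` into an integral over the line.

Now `∑ |⟨γ, g_p⟩|² = ⟨γ, Sγ⟩ = ab` contains the term `(ab)²` at `p = 0`, so `ab ≤ 1`. Moreover a
frame is a Riesz basis exactly when `⟨F_i, S⁻¹F_i⟩ = 1` for all `i`; here this number is always
`ab`, which settles (2) and (3). -/

/-! ### Frames and Riesz bases in a Hilbert space -/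

section Frames

variable {I H : Type*} [NormedAddCommGroup H] [InnerProductSpace ℂ H]

/-- The analysis operator `f ↦ (⟨f, Fᵢ⟩)ᵢ` of a family with square-summable coefficients and upper
frame bound `B`. -/
noncomputable def analysisOp (F : I → H) (B : ℝ)
    (hs : ∀ f : H, Summable (fun i => ‖inner ℂ (F i) f‖ ^ 2))
    (hB : ∀ f : H, ∑' i, ‖inner ℂ (F i) f‖ ^ 2 ≤ B * ‖f‖ ^ 2) :
    H →L[ℂ] lp (fun _ : I => ℂ) 2 :=
  LinearMap.mkContinuous
    { toFun := fun f => ⟨fun i => inner ℂ (F i) f, memℓp_gen (by simpa using hs f)⟩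
      map_add' := fun f h => by ext i; exact inner_add_right ..
      map_smul' := fun c f => by ext i; exact inner_smul_right .. }
    (Real.sqrt B) (fun f => by
      have h1 : ‖(⟨fun i => inner ℂ (F i) f, memℓp_gen (by simpa using hs f)⟩ :
          lp (fun _ : I => ℂ) 2)‖ ^ 2 = ∑' i, ‖inner ℂ (F i) f‖ ^ 2 := by
        have := lp.norm_rpow_eq_tsum (p := 2) (by norm_num)
          (⟨fun i => inner ℂ (F i) f, memℓp_gen (by simpa using hs f)⟩ : lp (fun _ : I => ℂ) 2)
        simpa using this
      have h2 := Real.sqrt_le_sqrt (h1.trans_le (hB f))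
      rw [Real.sqrt_sq (norm_nonneg _), Real.sqrt_mul' _ (sq_nonneg _),
        Real.sqrt_sq (norm_nonneg _)] at h2
      exact h2)

theorem analysisOp_apply (F : I → H) (B : ℝ)
    (hs : ∀ f : H, Summable (fun i => ‖inner ℂ (F i) f‖ ^ 2))
    (hB : ∀ f : H, ∑' i, ‖inner ℂ (F i) f‖ ^ 2 ≤ B * ‖f‖ ^ 2) (f : H) (i : I) :
    analysisOp F B hs hB f i = inner ℂ (F i) f := rfl

theorem adjoint_analysisOp_single [CompleteSpace H] [DecidableEq I] (F : I → H) (B : ℝ)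
    (hs : ∀ f : H, Summable (fun i => ‖inner ℂ (F i) f‖ ^ 2))
    (hB : ∀ f : H, ∑' i, ‖inner ℂ (F i) f‖ ^ 2 ≤ B * ‖f‖ ^ 2) (i : I) (c : ℂ) :
    (analysisOp F B hs hB).adjoint (lp.single 2 i c) = c • F i := by
  refine ext_inner_right ℂ fun v => ?_
  rw [ContinuousLinearMap.adjoint_inner_left, lp.inner_single_left, analysisOp_apply,
    inner_smul_left]
  simp [mul_comm]

theorem IsFrameOperator.hasSum_inner_mul_inner {F : I → H} {S : H →L[ℂ] H}
    (hS : IsFrameOperator F S) (f h : H) :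
    HasSum (fun i => inner ℂ (F i) f * inner ℂ h (F i)) (inner ℂ h (S f)) := by
  simpa [inner_smul_right] using (innerSL ℂ h).hasSum (hS f)

theorem IsFrameOperator.hasSum_norm_sq {F : I → H} {S : H →L[ℂ] H}
    (hS : IsFrameOperator F S) (f : H) :
    HasSum (fun i => ((‖inner ℂ (F i) f‖ ^ 2 : ℝ) : ℂ)) (inner ℂ f (S f)) := by
  convert hS.hasSum_inner_mul_inner f f using 2 with i
  rw [← inner_conj_symm f (F i), Complex.mul_conj, Complex.normSq_eq_norm_sq]

theorem IsFrameOperator.eq {F : I → H} {S S' : H →L[ℂ] H}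
    (hS : IsFrameOperator F S) (hS' : IsFrameOperator F S') : S = S' :=
  ContinuousLinearMap.ext fun f => (hS f).unique (hS' f)

variable [CompleteSpace H]

/-- The frame operator of a frame exists, is positive and boundedly invertible. -/
theorem IsFrame.exists_frameOperator {F : I → H} (hF : IsFrame F) :
    ∃ S : H ≃L[ℂ] H, IsFrameOperator F (S : H →L[ℂ] H) ∧ (S : H →L[ℂ] H).IsPositive := by
  classical
  obtain ⟨A, B, hA, -, h⟩ := hF
  set C := analysisOp F B (fun f => (h f).1) (fun f => (h f).2.2) with hC
  set S := C.adjoint ∘L C with hS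
  have hfr : IsFrameOperator F S := fun f => by
    have := C.adjoint.hasSum (lp.hasSum_single (by norm_num) (C f))
    simp only [hC, adjoint_analysisOp_single,
      analysisOp_apply] at this
    exact this
  have hpos : S.IsPositive := ContinuousLinearMap.isPositive_adjoint_comp_self C
  have hu : IsUnit S := by
    -- The lower frame bound is coercivity of the quadratic form of `S`.
    refine ContinuousLinearMap.isUnit_of_forall_le_norm_inner_map S (c := ⟨A, hA.le⟩) hA fun x => ?_
    have h1 := hfr.hasSum_norm_sq x
    have h2 : inner ℂ x (S x) = ((∑' i, ‖inner ℂ (F i) x‖ ^ 2 : ℝ) : ℂ) := by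
      rw [← h1.tsum_eq, Complex.ofReal_tsum]
    rw [norm_inner_symm, h2, Complex.norm_real, mul_comm]
    exact ((h x).2.1).trans (le_abs_self _)
  obtain ⟨u, hu⟩ := hu
  have he : (ContinuousLinearEquiv.unitsEquiv ℂ H u : H →L[ℂ] H) = S := hu
  exact ⟨ContinuousLinearEquiv.unitsEquiv ℂ H u, he ▸ hfr, he ▸ hpos⟩

/-- `S^{-1/2}` is invertible, symmetric, and squares to `S⁻¹`. -/
theorem exists_equiv_invSqrt (S : H ≃L[ℂ] H) (hS : (S : H →L[ℂ] H).IsPositive) :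
    ∃ R : H ≃L[ℂ] H, (R : H →L[ℂ] H) = invSqrt (S : H →L[ℂ] H) ∧
      (∀ x y, inner ℂ (R x) y = inner ℂ x (R y)) ∧ ∀ x, R (R x) = S.symm x := by
  obtain ⟨T, hT⟩ : ∃ T : H →L[ℂ] H, T = (S : H →L[ℂ] H) := ⟨_, rfl⟩
  rw [← hT] at hS ⊢
  have h0 : 0 ≤ T := T.nonneg_iff_isPositive.2 hS
  have hu : IsUnit T := ⟨(ContinuousLinearEquiv.unitsEquiv ℂ H).symm S, hT.symm⟩
  have hsp : IsStrictlyPositive T := IsStrictlyPositive.iff_of_unital.2 ⟨h0, hu⟩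
  have hR0 : 0 ≤ invSqrt T := CFC.rpow_nonneg
  have h1 : invSqrt T * T ^ (1 / 2 : ℝ) = 1 := by
    rw [invSqrt, neg_div]; exact CFC.rpow_neg_mul_rpow _ hsp
  have h2 : T ^ (1 / 2 : ℝ) * invSqrt T = 1 := by
    rw [invSqrt, neg_div]; exact CFC.rpow_mul_rpow_neg _ hsp
  have h3 : invSqrt T * invSqrt T * T = 1 := by
    have : T ^ (-1 / 2 : ℝ) * T ^ (-1 / 2 : ℝ) * T ^ (1 : ℝ) = 1 := by
      rw [← CFC.rpow_add hu, ← CFC.rpow_add hu]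
      norm_num
      exact CFC.rpow_zero T h0
    rwa [CFC.rpow_one T h0] at this
  refine ⟨ContinuousLinearEquiv.equivOfInverse (invSqrt T) (T ^ (1 / 2 : ℝ))
    (fun x => congr($h2 x)) (fun x => congr($h1 x)), rfl, fun x y => ?_, fun x => ?_⟩
  · exact ((invSqrt T).nonneg_iff_isPositive.1 hR0).isSymmetric x y
  · have := congr($h3 (S.symm x))
    simpa [hT] using this

/-- If the dual frame is normalised against the frame, the frame is a Riesz basis. -/
theorem isRieszBasis_of_inner_symm_eq_one {F : I → H} (S : H ≃L[ℂ] H)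
    (hS : IsFrameOperator F (S : H →L[ℂ] H)) (hp : (S : H →L[ℂ] H).IsPositive)
    (h1 : ∀ i, inner ℂ (F i) (S.symm (F i)) = 1) : IsRieszBasis F := by
  classical
  obtain ⟨R, -, hsymm, hsq⟩ := exists_equiv_invSqrt S hp
  have hoff : ∀ i j, j ≠ i → inner ℂ (F j) (S.symm (F i)) = 0 := fun i j hji => by
    have hs := IsFrameOperator.hasSum_norm_sq hS (S.symm (F i))
    have h2 : inner ℂ (S.symm (F i)) ((S : H →L[ℂ] H) (S.symm (F i))) = ((1 : ℝ) : ℂ) := by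
      simp only [ContinuousLinearEquiv.coe_coe, ContinuousLinearEquiv.apply_symm_apply]
      rw [← inner_conj_symm, h1, map_one, Complex.ofReal_one]
    rw [h2, Complex.hasSum_ofReal] at hs
    -- `∑ⱼ |⟨S⁻¹Fᵢ, Fⱼ⟩|² = ⟨S⁻¹Fᵢ, Fᵢ⟩ = 1`, and the term `j = i` already equals 1, so every other
    -- term vanishes.
    have h3 := sum_le_hasSum {i, j} (fun _ _ => sq_nonneg _) hs
    rw [Finset.sum_pair hji.symm, h1] at h3
    have : ‖inner ℂ (F j) (S.symm (F i))‖ ^ 2 ≤ 0 := by simpa using h3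
    simpa using le_antisymm this (sq_nonneg _)
  have hR : ∀ i j, inner ℂ (R (F i)) (R (F j)) = inner ℂ (F i) (S.symm (F j)) := fun i j => by
    rw [hsymm, hsq]
  have hon : Orthonormal ℂ (fun i => R (F i)) := by
    rw [orthonormal_iff_ite]
    intro i j
    rw [hR]
    split_ifs with h
    · rw [h, h1]
    · exact hoff j i h
  refine ⟨HilbertBasis.mkOfOrthogonalEqBot hon ?_, R.symm, fun i => by
    rw [HilbertBasis.coe_mkOfOrthogonalEqBot, R.symm_apply_apply]⟩
  rw [Submodule.eq_bot_iff]
  intro x hx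
  have h0 : ∀ i, inner ℂ (F i) (R x) = 0 := fun i => by
    rw [← hsymm]
    exact (Submodule.mem_orthogonal _ _).1 hx _ (Submodule.subset_span ⟨i, rfl⟩)
  have h4 : (S : H →L[ℂ] H) (R x) = 0 := (hS (R x)).unique (by simp [h0])
  simpa using h4

/-- For a Riesz basis, the dual frame is normalised against the frame. -/
theorem IsRieszBasis.inner_symm_eq_one {F : I → H} (hF : IsRieszBasis F) (S : H ≃L[ℂ] H)
    (hS : IsFrameOperator F (S : H →L[ℂ] H)) (i : I) : inner ℂ (F i) (S.symm (F i)) = 1 := by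
  obtain ⟨e, T, hT⟩ := hF
  -- `S = T T*`, so `T T* S⁻¹Fᵢ = T eᵢ`; injectivity of `T` then gives `T* S⁻¹Fᵢ = eᵢ`.
  have hST : (S : H →L[ℂ] H) = (T : H →L[ℂ] H) ∘L (T : H →L[ℂ] H).adjoint := by
    refine hS.eq fun f => ?_
    have h := (T : H →L[ℂ] H).hasSum (e.hasSum_repr ((T : H →L[ℂ] H).adjoint f))
    simpa [e.repr_apply_apply, ContinuousLinearMap.adjoint_inner_right, hT] using h
  set x := S.symm (F i)
  have hx : T ((T : H →L[ℂ] H).adjoint x) = T (e i) := by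
    rw [← hT, ← S.apply_symm_apply (F i)]
    exact congr($hST.symm x)
  have hx' := T.injective hx
  have := (T : H →L[ℂ] H).adjoint_inner_right (e i) x
  rw [hx', inner_self_eq_norm_sq_to_K, e.orthonormal.1] at this
  rw [hT]
  simpa using this.symm

end Frames

/-! ### Time-frequency shifts and the frame operator -/

section WeylHeisenberg

open ComplexConjugate

theorem expChar_add (b x y : ℝ) : expChar b (x + y) = expChar b x * expChar b y := by
  rw [expChar, expChar, expChar, ← Complex.exp_add]; congr 1; push_cast; ring

theorem expChar_add_left (b c x : ℝ) : expChar (b + c) x = expChar b x * expChar c x := by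
  rw [expChar, expChar, expChar, ← Complex.exp_add]; congr 1; push_cast; ring

theorem expChar_zero (x : ℝ) : expChar 0 x = 1 := by simp [expChar]

theorem conj_expChar (b x : ℝ) : conj (expChar b x) = expChar (-b) x := by
  rw [expChar, expChar, ← Complex.exp_conj]; congr 1
  simp only [map_mul, map_ofNat, Complex.conj_ofReal, Complex.conj_I]
  push_cast; ring

theorem expChar_mul_conj (b x : ℝ) : conj (expChar b x) * expChar b x = 1 := by
  rw [conj_expChar, ← expChar_add_left, neg_add_cancel, expChar_zero]

theorem expChar_eq_one {b x : ℝ} {k : ℤ} (h : b * x = k) : expChar b x = 1 := by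
  rw [expChar, Complex.exp_eq_one_iff]
  refine ⟨k, ?_⟩
  have : ((b * x : ℝ) : ℂ) = k := by rw [h]; simp
  push_cast at this
  rw [← this]; ring

theorem coeFn_modulation (c : ℝ) (f : L2R) :
    modulation c f =ᵐ[volume] fun x => expChar c x * f x :=
  MemLp.coeFn_toLp _

theorem coeFn_translation (d : ℝ) (f : L2R) :
    translation d f =ᵐ[volume] fun x => f (x - d) :=
  Lp.coeFn_compMeasurePreserving f (measurePreserving_sub_right volume d)

theorem ae_comp_sub {p : ℝ → Prop} (d : ℝ) (h : ∀ᵐ x, p x) : ∀ᵐ x, p (x - d) :=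
  (measurePreserving_sub_right volume d).quasiMeasurePreserving.ae h

theorem coeFn_modulation_translation (c d : ℝ) (f : L2R) :
    modulation c (translation d f) =ᵐ[volume] fun x => expChar c x * f (x - d) := by
  filter_upwards [coeFn_modulation c (translation d f), coeFn_translation d f] with x h1 h2
  rw [h1, h2]

theorem L2R_inner_eq (f h : L2R) : inner ℂ f h = ∫ x, conj (f x) * h x := by
  simp only [L2.inner_def, RCLike.inner_apply']

theorem inner_modulation (c : ℝ) (f h : L2R) :
    inner ℂ (modulation c f) (modulation c h) = inner ℂ f h := by
  rw [L2R_inner_eq, L2R_inner_eq]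
  refine integral_congr_ae ?_
  filter_upwards [coeFn_modulation c f, coeFn_modulation c h] with x h1 h2
  rw [h1, h2, map_mul]
  linear_combination conj (f x) * h x * expChar_mul_conj c x

theorem inner_translation (d : ℝ) (f h : L2R) :
    inner ℂ (translation d f) (translation d h) = inner ℂ f h := by
  rw [L2R_inner_eq, L2R_inner_eq,
    ← integral_sub_right_eq_self (fun x => conj (f x) * h x) d]
  refine integral_congr_ae ?_
  filter_upwards [coeFn_translation d f, coeFn_translation d h] with x h1 h2
  rw [h1, h2]

theorem modulation_modulation (c c' : ℝ) (f : L2R) :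
    modulation c (modulation c' f) = modulation (c + c') f := by
  refine Lp.ext ?_
  filter_upwards [coeFn_modulation c (modulation c' f), coeFn_modulation c' f,
    coeFn_modulation (c + c') f] with x h1 h2 h3
  rw [h1, h2, h3, expChar_add_left, mul_assoc]

theorem translation_translation (d d' : ℝ) (f : L2R) :
    translation d (translation d' f) = translation (d + d') f := by
  refine Lp.ext ?_
  filter_upwards [coeFn_translation d (translation d' f),
    ae_comp_sub d (coeFn_translation d' f), coeFn_translation (d + d') f] with x h1 h2 h3
  rw [h1, h2, h3, sub_sub]

theorem translation_modulation (c d : ℝ) (f : L2R) :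
    translation d (modulation c f) = expChar c (-d) • modulation c (translation d f) := by
  refine Lp.ext ?_
  filter_upwards [coeFn_translation d (modulation c f), ae_comp_sub d (coeFn_modulation c f),
    Lp.coeFn_smul (expChar c (-d)) (modulation c (translation d f)),
    coeFn_modulation_translation c d f] with x h1 h2 h3 h4
  rw [h1, h2, h3, Pi.smul_apply, h4, sub_eq_add_neg, expChar_add, smul_eq_mul]
  ring

theorem modulation_smul (c : ℝ) (z : ℂ) (f : L2R) :
    modulation c (z • f) = z • modulation c f := by
  refine Lp.ext ?_
  filter_upwards [coeFn_modulation c (z • f), Lp.coeFn_smul z f,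
    Lp.coeFn_smul z (modulation c f), coeFn_modulation c f] with x h1 h2 h3 h4
  rw [h1, h2, h3, Pi.smul_apply, Pi.smul_apply, h4, smul_eq_mul, smul_eq_mul]
  ring

theorem modulation_zero (f : L2R) : modulation 0 f = f := by
  refine Lp.ext ?_
  filter_upwards [coeFn_modulation 0 f] with x h1
  rw [h1, expChar_zero, one_mul]

theorem translation_zero (f : L2R) : translation 0 f = f := by
  refine Lp.ext ?_
  filter_upwards [coeFn_translation 0 f] with x h1
  rw [h1, sub_zero]

theorem whSystem_zero (g : L2R) (a b : ℝ) : whSystem g a b (0, 0) = g := by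
  simp [whSystem, modulation_zero, translation_zero]

theorem inner_whSystem (f h : L2R) (a b : ℝ) (p : ℤ × ℤ) :
    inner ℂ (whSystem f a b p) (whSystem h a b p) = inner ℂ f h := by
  rw [whSystem, whSystem, inner_modulation, inner_translation]

/-- Allows weak identities to be tested on shifted vectors only. -/
theorem whSystem_surjective (a b : ℝ) (p : ℤ × ℤ) (h : L2R) :
    ∃ k, whSystem k a b p = h :=
  ⟨translation (-(p.2 * a)) (modulation (-(p.1 * b)) h), by
    rw [whSystem, translation_translation, add_neg_cancel, translation_zero,
      modulation_modulation, add_neg_cancel, modulation_zero]⟩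

theorem whSystem_whSystem (g : L2R) (a b : ℝ) (p q : ℤ × ℤ) :
    ∃ z : ℂ, ‖z‖ = 1 ∧ whSystem (whSystem g a b q) a b p = z • whSystem g a b (p + q) := by
  refine ⟨expChar (q.1 * b) (-(p.2 * a)), norm_expChar _ _, ?_⟩
  rw [whSystem, whSystem, whSystem, translation_modulation, modulation_smul,
    modulation_modulation, translation_translation]
  simp [add_mul]

/-- The frame operator commutes with the time-frequency shifts. -/
theorem IsFrameOperator.whSystem_comm {g : L2R} {a b : ℝ} {S : L2R →L[ℂ] L2R}
    (hS : IsFrameOperator (whSystem g a b) S) (f : L2R) (p : ℤ × ℤ) :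
    S (whSystem f a b p) = whSystem (S f) a b p := by
  refine ext_inner_left ℂ fun h => ?_
  obtain ⟨k, rfl⟩ := whSystem_surjective a b p h
  have hw (f' h' : L2R) : HasSum (fun i => inner ℂ (whSystem g a b i) f' *
      inner ℂ h' (whSystem g a b i)) (inner ℂ h' (S f')) := by
    simpa [inner_smul_right] using (innerSL ℂ h').hasSum (hS f')
  rw [inner_whSystem]
  -- Reindexing by `q ↦ p + q` composes the shifts up to a unimodular phase, which cancels because
  -- `g_{p+q}` enters each term once linearly and once conjugate-linearly.
  refine ((Equiv.addLeft p).hasSum_iff.2 (hw (whSystem f a b p) (whSystem k a b p))).unique ?_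
  convert hw f k using 2 with q
  obtain ⟨z, hz, hq⟩ := whSystem_whSystem g a b p q
  have hz' : conj z * z = 1 := by rw [Complex.conj_mul', hz]; simp
  rw [← inner_whSystem (whSystem g a b q) f a b p, ← inner_whSystem k _ a b p, hq,
    inner_smul_left, inner_smul_right, Function.comp_apply, Equiv.coe_addLeft]
  linear_combination -(inner ℂ (whSystem g a b (p + q)) (whSystem f a b p) *
    inner ℂ (whSystem k a b p) (whSystem g a b (p + q))) * hz'

theorem IsFrameOperator.symm_whSystem {g : L2R} {a b : ℝ} {S : L2R ≃L[ℂ] L2R}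
    (hS : IsFrameOperator (whSystem g a b) (S : L2R →L[ℂ] L2R)) (p : ℤ × ℤ) :
    S.symm (whSystem g a b p) = whSystem (S.symm g) a b p := by
  rw [ContinuousLinearEquiv.symm_apply_eq]
  simpa using (hS.whSystem_comm (S.symm g) p).symm

end WeylHeisenberg

/-! ### Parseval's identity on an interval -/

section Parseval

open ComplexConjugate AddCircle

theorem HasSum.of_forall_eq {ι : Type*} {f f' : ι → ℂ} {s : ℂ} (h : HasSum f s)
    (he : ∀ i, f i = f' i) : HasSum f' s :=
  funext he ▸ h

theorem fourierCoeff_liftIoc_expChar {T : ℝ} [hT : Fact (0 < T)] (t : ℝ) (u : ℝ → ℂ) (m : ℤ) :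
    fourierCoeff (AddCircle.liftIoc T t u) m =
      (1 / T : ℝ) * ∫ x in Set.Ioc t (t + T), expChar (-(m * T⁻¹)) x * u x := by
  rw [fourierCoeff_liftIoc_eq, fourierCoeffOn_eq_integral, add_sub_cancel_left,
    intervalIntegral.integral_of_le (by linarith [hT.out]), Complex.real_smul]
  congr 2
  ext x
  rw [fourier_coe_apply, expChar, smul_eq_mul]
  congr 2
  push_cast
  ring

/-- Parseval's identity on an interval whose length is a period of the characters. -/
theorem hasSum_integral_expChar_mul {T : ℝ} (hT : 0 < T) (t : ℝ) {u v : ℝ → ℂ}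
    (hu : MemLp u 2 (volume.restrict (Set.Ioc t (t + T))))
    (hv : MemLp v 2 (volume.restrict (Set.Ioc t (t + T)))) :
    HasSum (fun m : ℤ => (∫ x in Set.Ioc t (t + T), expChar (-(m * T⁻¹)) x * u x) *
      ∫ x in Set.Ioc t (t + T), expChar (m * T⁻¹) x * v x)
      (T * ∫ x in Set.Ioc t (t + T), u x * v x) := by
  have : Fact (0 < T) := ⟨hT⟩
  have hT0 : (T : ℂ) ≠ 0 := by exact_mod_cast hT.ne'
  have hU := hu.memLp_liftIoc.haarAddCircle
  -- `v` is conjugated because the identity to prove is bilinear in `u` and `v`.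
  have hV := hv.star.memLp_liftIoc.haarAddCircle
  have h := fourierBasis.hasSum_inner_mul_inner hV.toLp hU.toLp
  have hcU (m : ℤ) : inner ℂ (fourierBasis m) hU.toLp = (1 / T : ℝ) *
      ∫ x in Set.Ioc t (t + T), expChar (-(m * T⁻¹)) x * u x := by
    rw [← HilbertBasis.repr_apply_apply, fourierBasis_repr,
      fourierCoeff_congr_ae hU.coeFn_toLp, fourierCoeff_liftIoc_expChar]
  have hcV (m : ℤ) : inner ℂ hV.toLp (fourierBasis m) = (1 / T : ℝ) *
      ∫ x in Set.Ioc t (t + T), expChar (m * T⁻¹) x * v x := by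
    rw [← inner_conj_symm, ← HilbertBasis.repr_apply_apply, fourierBasis_repr,
      fourierCoeff_congr_ae hV.coeFn_toLp, fourierCoeff_liftIoc_expChar, map_mul,
      Complex.conj_ofReal, ← integral_conj]
    congr 2
    ext x
    simp [conj_expChar]
  have hUV : inner ℂ hV.toLp hU.toLp =
      (1 / T : ℝ) * ∫ x in Set.Ioc t (t + T), u x * v x := by
    rw [L2.inner_def, ← intervalIntegral.integral_of_le (by linarith),
      ← AddCircle.integral_liftIoc_eq_intervalIntegral, volume_eq_smul_haarAddCircle,
      integral_smul_measure, ENNReal.toReal_ofReal hT.le, Complex.real_smul, ← mul_assoc,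
      ← Complex.ofReal_mul, one_div, inv_mul_cancel₀ hT.ne', Complex.ofReal_one, one_mul]
    refine integral_congr_ae ?_
    filter_upwards [hU.coeFn_toLp, hV.coeFn_toLp] with x h1 h2
    rw [h1, h2, RCLike.inner_apply]
    simp [AddCircle.liftIoc, Set.domRestrict_def]
  simp only [hcU, hcV, hUV] at h
  -- Each Fourier coefficient carries a factor `1/T`, as does the inner product; multiplying by `T²`
  -- leaves the single factor `T`.
  have key (z : ℂ) : (T : ℂ) ^ 2 * ((1 / T : ℝ) * z) = T * z := by
    push_cast; field_simp
  have h' := h.mul_left ((T : ℂ) ^ 2)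
  rw [key] at h'
  refine h'.of_forall_eq fun m => ?_
  rw [mul_assoc ((1 / T : ℝ) : ℂ), mul_left_comm _ ((1 / T : ℝ) : ℂ)]
  push_cast; field_simp

end Parseval

/-! ### Wexler-Raz biorthogonality -/

section WexlerRaz

open ComplexConjugate

theorem memLp_expChar_mul_conj_comp_sub (c d : ℝ) (γ : L2R) :
    MemLp (fun x => expChar c x * conj (γ (x - d))) 2 (volume : Measure ℝ) := by
  have h := (Lp.memLp γ).comp_measurePreserving (measurePreserving_sub_right volume d)
  refine h.of_le ((continuous_expChar c).aestronglyMeasurable.mul h.star.1)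
    (Filter.Eventually.of_forall fun x => ?_)
  simp [norm_expChar]

theorem integral_expChar_div {a : ℝ} (ha : 0 < a) (k : ℤ) :
    ∫ x in (0 : ℝ)..a, expChar (k / a) x = if k = 0 then (a : ℂ) else 0 := by
  split_ifs with hk
  · simp [hk, expChar_zero]
  · have hc : (2 * Real.pi * Complex.I * ((k / a : ℝ) : ℂ)) ≠ 0 := by
      have : ((k / a : ℝ) : ℂ) ≠ 0 := by
        exact_mod_cast div_ne_zero (by exact_mod_cast hk) ha.ne'
      exact mul_ne_zero Complex.two_pi_I_ne_zero this
    have h := integral_exp_mul_complex (a := 0) (b := a) hc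
    have h1 : expChar (k / a) a = 1 := expChar_eq_one (k := k) (by field_simp)
    rw [expChar] at h1
    simp only [expChar]
    rw [h, h1]
    simp

/-- The local form of the Wexler-Raz relations: Parseval's identity in the
modulation variable, tested on functions supported in an interval and its translate. -/
theorem hasSum_integral_translates {a b : ℝ} (ha : 0 < a) (hb : 0 < b) {γ g : L2R}
    (hd : ∀ f h : L2R, HasSum (fun p : ℤ × ℤ => inner ℂ (whSystem γ a b p) f *
      inner ℂ h (whSystem g a b p)) (inner ℂ h f))
    (k l : ℤ) (t s : ℝ) (hs : 0 ≤ s) (hsb : s ≤ b⁻¹) :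
    HasSum (fun n : ℤ => ((b⁻¹ : ℝ) : ℂ) * ∫ x in t..t + s,
        expChar (k / a) (x - n * a) * conj (γ (x - n * a)) * g (x - n * a - l / b))
      (if l = 0 then ∫ x in t..t + s, expChar (k / a) x else 0) := by
  set J := Set.Ioc t (t + s) with hJdef
  have hJ : MeasurableSet J := measurableSet_Ioc
  have hJf : volume J ≠ ∞ := measure_Ioc_lt_top.ne
  have hJs : Set.Ioc t (t + b⁻¹) ∩ J = J :=
    Set.inter_eq_right.2 (Set.Ioc_subset_Ioc_right (by linarith))
  have hts : t ≤ t + s := by linarith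
  set o : L2R := indicatorConstLp 2 hJ hJf (1 : ℂ) with ho
  have ho' : o =ᵐ[volume] J.indicator fun _ => (1 : ℂ) := indicatorConstLp_coeFn
  -- Test functions: `f` puts the modulation `k/a` next to `γ`, and the shift of `h` by `-l/b` moves
  -- onto `g` as a shift by `l/b`. Both pairings then become integrals over `J`.
  set f : L2R := modulation (k / a) o with hf
  set h : L2R := translation (-(l / b)) o with hh
  have hf' : f =ᵐ[volume] J.indicator (expChar (k / a)) := by
    filter_upwards [coeFn_modulation (k / a) o, ho'] with x h1 h2
    rw [h1, h2]
    by_cases hx : x ∈ J <;> simp [hx]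
  have hh' : h =ᵐ[volume] fun x => J.indicator (fun _ => (1 : ℂ)) (x + l / b) := by
    filter_upwards [coeFn_translation (-(l / b)) o, ae_comp_sub (-(l / b)) ho'] with x h1 h2
    rw [h1, h2, sub_neg_eq_add]
  have hfh : inner ℂ h f = if l = 0 then ∫ x in t..t + s, expChar (k / a) x else 0 := by
    rw [L2R_inner_eq]
    have h1 : ∫ x, conj (h x) * f x = ∫ x, if l = 0 then J.indicator (expChar (k / a)) x else 0 := by
      refine integral_congr_ae ?_
      filter_upwards [hf', hh'] with x h1 h2
      rw [h1, h2]
      split_ifs with hl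
      · by_cases hx : x ∈ J <;> simp [hx, hl]
      · by_cases hx : x ∈ J
        · have : x + l / b ∉ J := fun hx' => by
            rw [div_eq_mul_inv] at hx'
            have hT : 0 < b⁻¹ := inv_pos.2 hb
            obtain ⟨h3, h4⟩ := hx
            obtain ⟨h5, h6⟩ := hx'
            rcases lt_or_gt_of_ne hl with hl | hl
            · have : (l : ℝ) ≤ -1 := by exact_mod_cast Int.le_sub_one_of_lt hl
              nlinarith
            · have : (1 : ℝ) ≤ l := by exact_mod_cast hl
              nlinarith
          simp [this]
        · simp [hx]
    rw [h1]
    split_ifs with hl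
    · rw [integral_indicator hJ, intervalIntegral.integral_of_le hts]
    · simp
  have hγ (m n : ℤ) : inner ℂ (whSystem γ a b (m, n)) f = ∫ x in Set.Ioc t (t + b⁻¹),
      expChar (-(m * b)) x *
        J.indicator (fun x => expChar (k / a) x * conj (γ (x - n * a))) x := by
    simp_rw [← Set.indicator_mul_right J (expChar (-(m * b)))]
    rw [setIntegral_indicator hJ, hJs, ← integral_indicator hJ, L2R_inner_eq]
    refine integral_congr_ae ?_
    filter_upwards [coeFn_modulation_translation (m * b) (n * a) γ, hf'] with x h1 h2
    rw [whSystem, h1, h2]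
    by_cases hx : x ∈ J
    · simp only [Set.indicator_of_mem hx, map_mul, conj_expChar]; ring
    · simp [hx]
  have hg (m n : ℤ) : inner ℂ h (whSystem g a b (m, n)) = ∫ x in Set.Ioc t (t + b⁻¹),
      expChar (m * b) x * J.indicator (fun x => g (x - n * a - l / b)) x := by
    simp_rw [← Set.indicator_mul_right J (expChar (m * b))]
    rw [setIntegral_indicator hJ, hJs, ← integral_indicator hJ, L2R_inner_eq,
      ← integral_sub_right_eq_self _ (l / b : ℝ)]
    refine integral_congr_ae ?_
    filter_upwards [ae_comp_sub (l / b) (coeFn_modulation_translation (m * b) (n * a) g),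
      ae_comp_sub (l / b) hh'] with x h1 h2
    rw [whSystem, h1, h2, sub_add_cancel]
    by_cases hx : x ∈ J
    · have : expChar (m * b) (-(l / b)) = 1 :=
        expChar_eq_one (k := -(m * l)) (by push_cast; field_simp)
      rw [Set.indicator_of_mem hx, Set.indicator_of_mem hx, sub_right_comm,
        sub_eq_add_neg x (l / b : ℝ), expChar_add, this]
      simp
    · simp [hx]
  have hm (n : ℤ) : HasSum (fun m : ℤ => inner ℂ (whSystem γ a b (m, n)) f *
      inner ℂ h (whSystem g a b (m, n))) (((b⁻¹ : ℝ) : ℂ) * ∫ x in t..t + s,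
        expChar (k / a) (x - n * a) * conj (γ (x - n * a)) * g (x - n * a - l / b)) := by
    have hu := ((memLp_expChar_mul_conj_comp_sub (k / a) (n * a) γ).indicator hJ).restrict
      (Set.Ioc t (t + b⁻¹))
    have hv := ((((Lp.memLp g).comp_measurePreserving
      (measurePreserving_sub_right volume (l / b : ℝ))).comp_measurePreserving
      (measurePreserving_sub_right volume (n * a : ℝ))).indicator hJ).restrict
      (Set.Ioc t (t + b⁻¹))
    have hp := hasSum_integral_expChar_mul (inv_pos.2 hb) t hu hv
    simp only [inv_inv, ← Set.indicator_mul] at hp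
    rw [setIntegral_indicator hJ, hJs, ← intervalIntegral.integral_of_le hts] at hp
    simp only [hγ, hg]
    -- As `E_{k/a}` has period `a`, its argument may be shifted too, making the `n`-th integrand a
    -- translate by `na` of one fixed function.
    have he : ∫ x in t..t + s,
        expChar (k / a) (x - n * a) * conj (γ (x - n * a)) * g (x - n * a - l / b) =
          ∫ x in t..t + s, expChar (k / a) x * conj (γ (x - n * a)) * g (x - n * a - l / b) := by
      refine intervalIntegral.integral_congr fun x _ => ?_
      have : expChar (k / a) (-(n * a)) = 1 :=
        expChar_eq_one (k := -(k * n)) (by push_cast; field_simp)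
      simp only [sub_eq_add_neg x, expChar_add, this, mul_one]
    rw [he]
    exact hp
  rw [← hfh]
  exact ((Equiv.prodComm ℤ ℤ).hasSum_iff.2 (hd f h)).prod_fiberwise hm

theorem hasSum_intervalIntegral_comp_sub_mul {a : ℝ} (ha : 0 < a) {φ : ℝ → ℂ}
    (hφ : Integrable φ) :
    HasSum (fun n : ℤ => ∫ x in (0 : ℝ)..a, φ (x - n * a)) (∫ x, φ x) := by
  have h := hasSum_integral_iUnion (μ := volume) (f := φ)
    (s := fun n : ℤ => Set.Ioc (n • a) ((n + 1) • a)) (fun _ => measurableSet_Ioc)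
    (Set.pairwise_disjoint_Ioc_zsmul a) hφ.integrableOn
  rw [iUnion_Ioc_zsmul ha, setIntegral_univ] at h
  -- The substitution `x ↦ x - na` carries `(0, a]` to the cell of index `-n`.
  refine ((Equiv.neg ℤ).hasSum_iff.2 h).of_forall_eq fun n => ?_
  rw [intervalIntegral.integral_comp_sub_right (fun x => φ x),
    intervalIntegral.integral_of_le (by linarith)]
  simp only [Function.comp_apply, Equiv.neg_apply, zsmul_eq_mul]
  push_cast
  congr 3 <;> ring

/-- **Wexler-Raz biorthogonality relations**. -/
theorem integral_mul_conj_of_hasSum_dual {a b : ℝ} (ha : 0 < a) (hb : 0 < b) {γ g : L2R}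
    (hd : ∀ f h : L2R, HasSum (fun p : ℤ × ℤ => inner ℂ (whSystem γ a b p) f *
      inner ℂ h (whSystem g a b p)) (inner ℂ h f)) (k l : ℤ) :
    inner ℂ γ (modulation (k / a) (translation (l / b) g)) =
      if l = 0 ∧ k = 0 then (a * b : ℂ) else 0 := by
  set φ : ℝ → ℂ := fun x => expChar (k / a) x * conj (γ x) * g (x - l / b) with hφdef
  have hφ : Integrable φ := by
    have h1 := memLp_expChar_mul_conj_comp_sub (k / a) 0 γ
    simp only [sub_zero] at h1
    exact h1.integrable_mul
      ((Lp.memLp g).comp_measurePreserving (measurePreserving_sub_right volume (l / b : ℝ)))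
  -- The local relations need intervals no longer than `1/b`; `N > ab` makes `N` pieces of length
  -- `a/N` admissible, and they fill `[0, a]`.
  obtain ⟨N, hN⟩ := exists_nat_gt (a * b)
  have hN0 : (0 : ℝ) < N := (mul_pos ha hb).trans hN
  have hs : a / N ≤ b⁻¹ := by
    rw [div_le_iff₀ hN0, inv_mul_eq_div, le_div_iff₀ hb]; exact hN.le
  have hj := hasSum_sum (s := Finset.range N) fun j _ =>
    hasSum_integral_translates ha hb hd k l (j * (a / N)) (a / N) (by positivity) hs
  have hadj (ψ : ℝ → ℂ) (hψ : ∀ u v, IntervalIntegrable ψ volume u v) :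
      ∑ j ∈ Finset.range N, ∫ x in (j * (a / N) : ℝ)..j * (a / N) + a / N, ψ x =
        ∫ x in (0 : ℝ)..a, ψ x := by
    have := intervalIntegral.sum_integral_adjacent_intervals (μ := volume) (f := ψ)
      (a := fun j : ℕ => (j * (a / N) : ℝ)) (n := N) fun _ _ => hψ _ _
    convert this using 3 <;> first | (push_cast; ring1) | simp | field_simp
  have hl : ∑ j ∈ Finset.range N, (if l = 0 then
      ∫ x in (j * (a / N) : ℝ)..j * (a / N) + a / N, expChar (k / a) x else 0) =
        if l = 0 ∧ k = 0 then (a : ℂ) else 0 := by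
    rw [ite_and]
    split_ifs with h1 h2
    · rw [hadj _ fun _ _ => (continuous_expChar _).intervalIntegrable _ _,
        integral_expChar_div ha, if_pos h2]
    · rw [hadj _ fun _ _ => (continuous_expChar _).intervalIntegrable _ _,
        integral_expChar_div ha, if_neg h2]
    · simp
  have hr (n : ℤ) : ∑ j ∈ Finset.range N, ((b⁻¹ : ℝ) : ℂ) *
      ∫ x in (j * (a / N) : ℝ)..j * (a / N) + a / N, φ (x - n * a) =
        ((b⁻¹ : ℝ) : ℂ) * ∫ x in (0 : ℝ)..a, φ (x - n * a) := by
    rw [← Finset.mul_sum, hadj _ fun u v => (hφ.comp_sub_right _).intervalIntegrable]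
  rw [hl] at hj
  replace hj := hj.of_forall_eq hr
  have hu := hj.unique ((hasSum_intervalIntegral_comp_sub_mul ha hφ).mul_left _)
  have hb0 : (b : ℂ) ≠ 0 := by exact_mod_cast hb.ne'
  have hi : inner ℂ γ (modulation (k / a) (translation (l / b) g)) = ∫ x, φ x := by
    rw [L2R_inner_eq]
    refine integral_congr_ae ?_
    filter_upwards [coeFn_modulation_translation (k / a) (l / b) g] with x h1
    rw [h1, hφdef]
    ring
  have hb1 : (b : ℂ) * ((b⁻¹ : ℝ) : ℂ) = 1 := by push_cast; field_simp
  rw [hi, ← one_mul (∫ x, φ x), ← hb1, mul_assoc, ← hu]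
  split_ifs <;> ring

end WexlerRaz

/-! ### The main theorem -/

theorem corollary2p3 (g : L2R) (a b : ℝ) (ha : 0 < a) (hb : 0 < b)
    (hg : IsFrame (whSystem g a b)) :
    -- the frame operator exists, is positive and boundedly invertible, and part (1) holds for it
    (∃ S : L2R ≃L[ℂ] L2R,
      IsFrameOperator (whSystem g a b) (S : L2R →L[ℂ] L2R) ∧
      (S : L2R →L[ℂ] L2R).IsPositive ∧
      (∀ m n : ℤ, (m, n) ≠ (0, 0) →
        inner ℂ (modulation (n / a) (translation (m / b) g)) (S.symm g) = 0) ∧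
      inner ℂ g (S.symm g) =
        inner ℂ (invSqrt (S : L2R →L[ℂ] L2R) g) (invSqrt (S : L2R →L[ℂ] L2R) g) ∧
      inner ℂ (invSqrt (S : L2R →L[ℂ] L2R) g) (invSqrt (S : L2R →L[ℂ] L2R) g) =
        ((‖invSqrt (S : L2R →L[ℂ] L2R) g‖ ^ 2 : ℝ) : ℂ) ∧
      ‖invSqrt (S : L2R →L[ℂ] L2R) g‖ ^ 2 = a * b ∧
      a * b ≤ 1) ∧
    -- part (2)
    (a * b < 1 → ¬ IsRieszBasis (whSystem g a b)) ∧
    -- part (3)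
    (a * b = 1 → IsRieszBasis (whSystem g a b)) := by
  obtain ⟨S, hS, hpos⟩ := hg.exists_frameOperator
  obtain ⟨R, hR, hsymm, hsq⟩ := exists_equiv_invSqrt S hpos
  have hdual : ∀ f h : L2R, HasSum (fun p : ℤ × ℤ => inner ℂ (whSystem (S.symm g) a b p) f *
      inner ℂ h (whSystem g a b p)) (inner ℂ h f) := fun f h => by
    have hi := hS.hasSum_inner_mul_inner (S.symm f) h
    rw [ContinuousLinearEquiv.coe_coe, S.apply_symm_apply] at hi
    refine hi.of_forall_eq fun p => ?_
    -- Self-adjointness of `S⁻¹ = R²` moves it from `f` to `g_p`.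
    rw [← hS.symm_whSystem, ← hsq, ← hsq, hsymm, hsymm]
  have hWR := integral_mul_conj_of_hasSum_dual ha hb hdual
  have hg0 : inner ℂ g (S.symm g) = (a * b : ℂ) := by
    have := hWR 0 0
    simp only [Int.cast_zero, zero_div, modulation_zero, translation_zero, and_self,
      if_true] at this
    rw [← inner_conj_symm, this]
    simp
  have hinner : inner ℂ g (S.symm g) = inner ℂ (R g) (R g) := by rw [hsymm, hsq]
  have hnorm : inner ℂ (R g) (R g) = ((‖R g‖ ^ 2 : ℝ) : ℂ) := by
    rw [inner_self_eq_norm_sq_to_K]; norm_cast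
  have hab : ‖R g‖ ^ 2 = a * b := by
    have := hnorm.symm.trans (hinner.symm.trans hg0)
    exact_mod_cast this
  have hp (p : ℤ × ℤ) :
      inner ℂ (whSystem g a b p) (S.symm (whSystem g a b p)) = (a * b : ℂ) := by
    rw [hS.symm_whSystem, inner_whSystem, hg0]
  refine ⟨⟨S, hS, hpos, fun m n hmn => ?_, ?_⟩, fun hlt hF => ?_, fun h1 => ?_⟩
  · rw [← inner_conj_symm, hWR n m, if_neg fun h => hmn (Prod.ext h.1 h.2), map_zero]
  · rw [← hR]
    refine ⟨hinner, hnorm, hab, ?_⟩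
    have hs := IsFrameOperator.hasSum_norm_sq hS (S.symm g)
    rw [ContinuousLinearEquiv.coe_coe, S.apply_symm_apply, ← inner_conj_symm, hg0,
      ← Complex.ofReal_mul, Complex.conj_ofReal, Complex.hasSum_ofReal] at hs
    -- The `(0, 0)` term `(ab)²` is at most the whole sum `ab`.
    have hle := le_hasSum hs (0, 0) fun _ _ => sq_nonneg _
    rw [whSystem_zero, hg0, ← Complex.ofReal_mul, Complex.norm_real, Real.norm_eq_abs,
      sq_abs] at hle
    nlinarith [mul_pos ha hb]
  · have := (hp (0, 0)).symm.trans (hF.inner_symm_eq_one S hS (0, 0))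
    exact hlt.ne (by exact_mod_cast this)
  · exact isRieszBasis_of_inner_symm_eq_one S hS hpos fun p => (hp p).trans (by exact_mod_cast h1)
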